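/- For a ring $R$, an automorphism $\phi$ of $R$ and a central non-zero-divisor $z\in R$, let $H(R,\phi,z)$ be the generalized Weyl algebra generated over $R$ by $x,y$ subject to $yx=z$, $xy=\phi^{-1}(z)$, $xr=\phi^{-1}(r)x$, $yr=\phi(r)y$ for all $r\in R$, and let $\mathcal{O}(H(R,\phi,z))$ be the full subcategory of the category of left $H(R,\phi,z)$-modules consisting of the modules on which $x$ acts locally nilpotently. For a commutative ring $\mathbf{k}$, let $\phi$ be the automorphism $f(h)\mapsto f(h+1)$ of $\mathbf{k}[h]$, and for $v\in\mathbf{k}[h]$ not a zero-divisor and a positive integer $p$ put $A(v)=H(\mathbf{k}[h],\phi,v)$ and $A(v,p)=H(\mathbf{k}[h],\phi^p,v)$ (so that $\phi^p$ is translation by $p$). Let $\mathbf{k}$ be a commutative ring and let $p$ be a prime number whose image in $\mathbf{k}$ is nilpotent. Let $v=\prod_{i=1}^m(h-\lambda_i)$ with $\lambda_1,\dots,\lambda_m\in\mathbf{k}$, such that whenever $\lambda_i\neq\lambda_j$, the element $\lambda_i-\lambda_j-n$ is a unit of $\mathbf{k}$ for every $n\in\mathbb{Z}$ (for example, $v=h^m$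 with $m\geq 1$). Then the categories $\mathcal{O}(A(v))$ and $\mathcal{O}(A(v,p))$ are equivalent. -/

import Mathlib

open CategoryTheory Polynomial

universe u w

/-- Generators of a generalized Weyl algebra: one for each coefficient `r : R`, and `x`, `y`. -/
inductive GWAGen (R : Type u) : Type u
  | coeff (r : R) : GWAGen R
  | x : GWAGen R
  | y : GWAGen R

namespace GWAGen

/-- The generator of the free ring `ℤ⟨r, x, y⟩` attached to `r : R`. -/
noncomputable abbrev fC {R : Type u} (r : R) : FreeAlgebra ℤ (GWAGen R) :=
  FreeAlgebra.ι ℤ (GWAGen.coeff r)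

/-- The generator `x` of the free ring. -/
noncomputable abbrev fX (R : Type u) : FreeAlgebra ℤ (GWAGen R) :=
  FreeAlgebra.ι ℤ GWAGen.x

/-- The generator `y` of the free ring. -/
noncomputable abbrev fY (R : Type u) : FreeAlgebra ℤ (GWAGen R) :=
  FreeAlgebra.ι ℤ GWAGen.y

end GWAGen

open GWAGen in
/-- The defining relations of a generalized Weyl algebra. The first three say that the generators
attached to elements of `R` form the image of a ring homomorphism from `R`; the other four are
`yx = z`, `xy = φ⁻¹(z)`, `xr = φ⁻¹(r)x`, `yr = φ(r)y`. -/
inductive GWARel {R : Type u} [Ring R] (φ : R ≃+* R) (z : R) :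
    FreeAlgebra ℤ (GWAGen R) → FreeAlgebra ℤ (GWAGen R) → Prop
  | one : GWARel φ z (fC 1) 1
  | add (r s : R) : GWARel φ z (fC (r + s)) (fC r + fC s)
  | mul (r s : R) : GWARel φ z (fC (r * s)) (fC r * fC s)
  | yx : GWARel φ z (fY R * fX R) (fC z)
  | xy : GWARel φ z (fX R * fY R) (fC (φ.symm z))
  | x_coeff (r : R) : GWARel φ z (fX R * fC r) (fC (φ.symm r) * fX R)
  | y_coeff (r : R) : GWARel φ z (fY R * fC r) (fC (φ r) * fY R)

/-- The generalized Weyl algebra `H(R, φ, z)`: the ring generated over `R` by `x`, `y` subject to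
`yx = z`, `xy = φ⁻¹(z)`, `xr = φ⁻¹(r)x`, `yr = φ(r)y`. It is used for `z` central in `R` and not
a zero divisor. -/
def GWA {R : Type u} [Ring R] (φ : R ≃+* R) (z : R) : Type u :=
  RingQuot (GWARel φ z)

namespace GWA

noncomputable instance {R : Type u} [Ring R] (φ : R ≃+* R) (z : R) : Ring (GWA φ z) :=
  inferInstanceAs (Ring (RingQuot (GWARel φ z)))

/-- The generator `x` of `H(R, φ, z)`. -/
noncomputable def x {R : Type u} [Ring R] (φ : R ≃+* R) (z : R) : GWA φ z :=
  RingQuot.mkRingHom (GWARel φ z) (GWAGen.fX R)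

/-- The property of left `H(R, φ, z)`-modules that `x` acts locally nilpotently. -/
def isCategoryO {R : Type u} [Ring R] (φ : R ≃+* R) (z : R) :
    ObjectProperty (ModuleCat.{w} (GWA φ z)) :=
  fun M => ∀ m : M, ∃ n : ℕ, (x φ z) ^ n • m = 0

/-- The category `𝒪(H(R, φ, z))`: the full subcategory of left `H(R, φ, z)`-modules on which `x`
acts locally nilpotently. -/
abbrev CategoryO {R : Type u} [Ring R] (φ : R ≃+* R) (z : R) :=
  (isCategoryO.{u, w} φ z).FullSubcategory

end GWA

/-- The automorphism `f(h) ↦ f(h + 1)` of `k[h]`. -/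
noncomputable def polyShift (k : Type u) [CommRing k] : RingAut k[X] :=
  (Polynomial.algEquivAevalXAddC (1 : k)).toRingEquiv

/-- The category `𝒪(A(v))`, where `A(v) = H(k[h], φ, v)` and `φ` is translation by `1`. -/
abbrev CategoryOA {k : Type u} [CommRing k] (v : k[X]) :=
  GWA.CategoryO.{u, w} (polyShift k) v

/-- The category `𝒪(A(v, p))`, where `A(v, p) = H(k[h], φ ^ p, v)` and `φ` is translation by `1`,
so that `φ ^ p` is translation by `p`. -/
abbrev CategoryOAp {k : Type u} [CommRing k] (v : k[X]) (p : ℕ) :=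
  GWA.CategoryO.{u, w} (polyShift k ^ p) v

/-! Put `p = q + 1`. Since `p` is nilpotent in `k`, `φ ^ p` is the identity up to nilpotents, while
the condition on the roots makes `v`, `φ v`, …, `φ ^ q v` pairwise coprime. Nothing else about
`k[h]` is needed, so the argument runs for a commutative ring `R` with these two properties, with
`z` for `v`.

If `x ^ n` kills `m`, then so does `y ^ n * x ^ n`, a product of translates of `z`. Up to nilpotents
these translates repeat with period `p`, so `m` is power torsion for `∏_{j < p} φ ^ j z`. Hence a
module `M` of `𝒪(H(R, φ, z))` is the direct sum of its `φ ^ i z`-power torsion parts `M_i`, `0 ≤ i ≤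
q`, which `y` and `x` permute cyclically, in opposite directions. For `i ≤ q`, `y ^ i : M_0 → M_i`
is bijective, because `x ^ i * y ^ i` is invertible on `M_0` and `y ^ i * x ^ i` on `M_i`. So `M` is
recovered from `M_0` with the operators `Y = y ^ p` and `X = (y ^ q)⁻¹ x`, which satisfy the
relations of `H(R, φ ^ p, z)`; for instance `Y X = y x = z`.

The equivalence is realized by the reverse functor, `N ↦ N ^ p` with `y` a cyclic shift twisted by
`Y`. It is full and faithful because torsion separates the copies (`inducedMap_surjective`), and
essentially surjective by `exists_torsion_action`, `bijective_fromInducedAddHom` and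
`locally_nilpotent_of_induced`. -/

/-! ### Power torsion in modules over a commutative ring -/

section Torsion

variable {R : Type*} {M : Type*} [CommRing R] [AddCommGroup M] [Module R M]

theorem exists_smul_eq_of_isCoprime {a b : R} (h : IsCoprime a b) {m : M}
    (hm : ∃ e : ℕ, b ^ e • m = 0) : ∃ c : R, (c * a) • m = m := by
  obtain ⟨e, he⟩ := hm
  obtain ⟨c, d, hcd⟩ := h.pow_right (n := e)
  refine ⟨c, ?_⟩
  have := congrArg (· • m) hcd
  simpa [add_smul, mul_smul, he] using this

theorem eq_zero_of_smul_eq_zero_of_isCoprime {a b : R} (h : IsCoprime a b) {m : M}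
    (ha : a • m = 0) (hm : ∃ e : ℕ, b ^ e • m = 0) : m = 0 := by
  obtain ⟨c, hc⟩ := exists_smul_eq_of_isCoprime h hm
  rw [← hc, mul_smul, ha, smul_zero]

theorem exists_dvd_pow_of_isNilpotent_sub {a b : R} (h : IsNilpotent (a - b)) :
    ∃ e : ℕ, a ∣ b ^ e := by
  obtain ⟨e, he⟩ := h
  refine ⟨e, ?_⟩
  have h1 : a ∣ (b - (b - a)) := by simp
  have h2 := h1.trans (sub_dvd_pow_sub_pow b (b - a) e)
  rwa [← neg_sub a b, neg_pow, he, mul_zero, sub_zero] at h2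

/-- Power torsion depends only on the element modulo nilpotents; this is what makes the parts `M_i`
periodic in `i`. -/
theorem exists_pow_smul_eq_zero_of_isNilpotent_sub {a b : R} (h : IsNilpotent (a - b)) {m : M}
    (hm : ∃ e : ℕ, a ^ e • m = 0) : ∃ e : ℕ, b ^ e • m = 0 := by
  obtain ⟨n, hn⟩ := hm
  obtain ⟨e, c, hc⟩ := exists_dvd_pow_of_isNilpotent_sub h
  refine ⟨e * n, ?_⟩
  rw [pow_mul, hc, mul_pow, mul_comm, mul_smul, hn, smul_zero]

theorem exists_eq_sum_of_pairwise_isCoprime {ι : Type*} [Fintype ι] {a : ι → R}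
    (ha : Pairwise fun i j => IsCoprime (a i) (a j)) {m : M} {e : ℕ}
    (hm : (∏ i, a i) ^ e • m = 0) :
    ∃ f : ι → M, (∀ i, a i ^ e • f i = 0) ∧ ∑ i, f i = m := by
  classical
  have h := Submodule.iSup_torsionBy_eq_torsionBy_prod (M := M) (S := Finset.univ)
    (q := fun i => a i ^ e) fun i _ j _ hij => (ha hij).pow
  have hm' : m ∈ Submodule.torsionBy R M (∏ i, a i ^ e) := by
    rwa [Submodule.mem_torsionBy_iff, Finset.prod_pow]
  rw [← h, Submodule.mem_iSup_finset_iff_exists_sum] at hm'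
  obtain ⟨f, hf⟩ := hm'
  exact ⟨fun i => f i, fun i => (f i).2, hf⟩

theorem eq_zero_of_sum_eq_zero_of_pairwise_isCoprime {ι : Type*} [Fintype ι] {a : ι → R}
    (ha : Pairwise fun i j => IsCoprime (a i) (a j)) {f : ι → M}
    (hf : ∀ i, ∃ e : ℕ, a i ^ e • f i = 0) (h : ∑ i, f i = 0) (i : ι) : f i = 0 := by
  classical
  choose e he using hf
  -- `c` kills every summand except the `i`-th, on which it is injective.
  let c := ∏ j ∈ Finset.univ.erase i, a j ^ e j
  have hc : IsCoprime c (a i) :=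
    IsCoprime.prod_left fun j hj => (ha (Finset.ne_of_mem_erase hj)).pow_left
  refine eq_zero_of_smul_eq_zero_of_isCoprime hc ?_ ⟨e i, he i⟩
  have h' := congrArg (c • ·) h
  simp only [Finset.smul_sum, smul_zero] at h'
  rwa [Finset.sum_eq_single i _ (by simp)] at h'
  intro j _ hj
  rw [show c = (∏ l ∈ (Finset.univ.erase i).erase j, a l ^ e l) * a j ^ e j from
    (Finset.prod_erase_mul _ _ (by simp [hj])).symm, mul_smul, he, smul_zero]

end Torsion

/-! ### Generalized Weyl algebras: relations, modules, linear maps -/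

namespace GWA

section Basic

variable {R : Type u} [Ring R] (φ : R ≃+* R) (z : R)

/-- The structure map `R → H(R, φ, z)`. -/
noncomputable def coeff : R →+* GWA φ z where
  toFun r := RingQuot.mkRingHom (GWARel φ z) (GWAGen.fC r)
  map_one' := (RingQuot.mkRingHom_rel GWARel.one).trans (map_one _)
  map_mul' r s := (RingQuot.mkRingHom_rel (GWARel.mul r s)).trans (map_mul _ _ _)
  map_zero' := by
    have h := (RingQuot.mkRingHom_rel (GWARel.add (φ := φ) (z := z) 0 0)).trans (map_add _ _ _)
    rw [add_zero] at h
    exact left_eq_add.mp h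
  map_add' r s := (RingQuot.mkRingHom_rel (GWARel.add r s)).trans (map_add _ _ _)

/-- The generator `y` of `H(R, φ, z)`. -/
noncomputable def y : GWA φ z :=
  RingQuot.mkRingHom (GWARel φ z) (GWAGen.fY R)

theorem y_mul_x : y φ z * x φ z = coeff φ z z :=
  (map_mul _ _ _).symm.trans (RingQuot.mkRingHom_rel GWARel.yx)

theorem x_mul_y : x φ z * y φ z = coeff φ z (φ.symm z) :=
  (map_mul _ _ _).symm.trans (RingQuot.mkRingHom_rel GWARel.xy)

theorem x_mul_coeff (r : R) : x φ z * coeff φ z r = coeff φ z (φ.symm r) * x φ z :=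
  (map_mul _ _ _).symm.trans ((RingQuot.mkRingHom_rel (GWARel.x_coeff r)).trans (map_mul _ _ _))

theorem y_mul_coeff (r : R) : y φ z * coeff φ z r = coeff φ z (φ r) * y φ z :=
  (map_mul _ _ _).symm.trans ((RingQuot.mkRingHom_rel (GWARel.y_coeff r)).trans (map_mul _ _ _))

variable {φ z}

theorem induction {P : GWA φ z → Prop} (hc : ∀ r, P (coeff φ z r)) (hx : P (x φ z))
    (hy : P (y φ z)) (hadd : ∀ a b, P a → P b → P (a + b)) (hmul : ∀ a b, P a → P b → P (a * b))
    (a : GWA φ z) : P a := by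
  obtain ⟨a, rfl⟩ := RingQuot.mkRingHom_surjective (GWARel φ z) a
  induction a using FreeAlgebra.induction with
  | grade0 n =>
    have h := hc (n : R)
    rw [map_intCast] at h
    have e : RingQuot.mkRingHom (GWARel φ z) (algebraMap ℤ (FreeAlgebra ℤ (GWAGen R)) n) = n := by
      simp
    rw [e]
    exact h
  | grade1 g =>
    cases g with
    | coeff r => exact hc r
    | x => exact hx
    | y => exact hy
  | mul a b ha hb => rw [map_mul]; exact hmul _ _ ha hb
  | add a b ha hb => rw [map_add]; exact hadd _ _ ha hb

/-- Additive endomorphisms of `M` satisfying the relations of `H(R, φ, z)`. -/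
structure ActionData (φ : R ≃+* R) (z : R) (M : Type*) [AddCommGroup M] where
  /-- the action of `R` -/
  c : R → M →+ M
  /-- the action of `x` -/
  X : M →+ M
  /-- the action of `y` -/
  Y : M →+ M
  c_one : ∀ m, c 1 m = m
  c_add : ∀ r s m, c (r + s) m = c r m + c s m
  c_mul : ∀ r s m, c (r * s) m = c r (c s m)
  yx : ∀ m, Y (X m) = c z m
  xy : ∀ m, X (Y m) = c (φ.symm z) m
  xc : ∀ r m, X (c r m) = c (φ.symm r) (X m)
  yc : ∀ r m, Y (c r m) = c (φ r) (Y m)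

namespace ActionData

variable {M : Type*} [AddCommGroup M] (D : ActionData φ z M)

/-- The action of the generators. -/
def gen : GWAGen R → AddMonoid.End M
  | .coeff r => D.c r
  | .x => D.X
  | .y => D.Y

/-- The action of `H(R, φ, z)` given by its universal property. -/
noncomputable def lift : GWA φ z →+* AddMonoid.End M :=
  RingQuot.lift ⟨(FreeAlgebra.lift ℤ D.gen).toRingHom, by
    intro a b h
    refine AddMonoidHom.ext fun m => ?_
    cases h with
    | one => simpa using! D.c_one m
    | add r s => simpa using! D.c_add r s m
    | mul r s => simpa using! D.c_mul r s m
    | yx => simpa using! D.yx m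
    | xy => simpa using! D.xy m
    | x_coeff r => simpa using! D.xc r m
    | y_coeff r => simpa using! D.yc r m⟩

/-- The module structure attached to an action. -/
noncomputable abbrev toModule : Module (GWA φ z) M :=
  Module.compHom M D.lift

theorem coeff_smul (r : R) (m : M) : letI := D.toModule; coeff φ z r • m = D.c r m :=
  congrArg (fun f : AddMonoid.End M => f m)
    ((RingQuot.lift_mkRingHom_apply _ _ _).trans (FreeAlgebra.lift_ι_apply D.gen _))

theorem x_smul (m : M) : letI := D.toModule; x φ z • m = D.X m :=
  congrArg (fun f : AddMonoid.End M => f m)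
    ((RingQuot.lift_mkRingHom_apply _ _ _).trans (FreeAlgebra.lift_ι_apply D.gen _))

theorem y_smul (m : M) : letI := D.toModule; y φ z • m = D.Y m :=
  congrArg (fun f : AddMonoid.End M => f m)
    ((RingQuot.lift_mkRingHom_apply _ _ _).trans (FreeAlgebra.lift_ι_apply D.gen _))

end ActionData

/-- An additive map commuting with `R`, `x` and `y` is `H(R, φ, z)`-linear. -/
def linearMapMk {M N : Type*} [AddCommGroup M] [AddCommGroup N] [Module (GWA φ z) M]
    [Module (GWA φ z) N] (f : M →+ N) (hc : ∀ r m, f (coeff φ z r • m) = coeff φ z r • f m)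
    (hx : ∀ m, f (x φ z • m) = x φ z • f m) (hy : ∀ m, f (y φ z • m) = y φ z • f m) :
    M →ₗ[GWA φ z] N where
  __ := f
  map_smul' a := by
    induction a using GWA.induction with
    | hc r => exact hc r
    | hx => exact hx
    | hy => exact hy
    | hadd a b ha hb =>
      intro m
      have := congrArg₂ (· + ·) (ha m) (hb m)
      simpa [add_smul] using this
    | hmul a b ha hb =>
      intro m
      have := (ha (b • m)).trans (congrArg (a • ·) (hb m))
      simpa [mul_smul] using this

end Basic

end GWA

/-! ### Translations of `k[h]`: the two properties used later -/

section PolyShift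

variable {k : Type u} [CommRing k]

theorem polyShift_pow_apply (n : ℕ) (f : k[X]) :
    (polyShift k ^ n) f = f.comp (X + C (n : k)) := by
  induction n generalizing f with
  | zero => simp
  | succ n ih =>
    rw [pow_succ', RingAut.mul_apply, ih]
    change aeval (X + C 1) _ = _
    rw [← comp_eq_aeval, comp_assoc]
    simp [add_assoc, add_comm]

theorem isNilpotent_polyShift_pow_sub {n : ℕ} (hn : IsNilpotent (n : k)) (f : k[X]) :
    IsNilpotent ((polyShift k ^ n) f - f) := by
  rw [polyShift_pow_apply]
  -- Viewing `f` as a polynomial over `k[X]` and evaluating at `X + n` and `X` shows that `n`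
  -- divides `f(X + n) - f(X)`.
  have h := sub_dvd_eval_sub (X + C (n : k)) X (f.map C)
  rw [Polynomial.eval_map, Polynomial.eval_map, ← comp, ← comp, comp_X, add_sub_cancel_left] at h
  obtain ⟨c, hc⟩ := h
  rw [hc]
  exact (Commute.all _ _).isNilpotent_mul_right (hn.map C)

/-- In `k`, `n` is coprime to a power of `p` that vanishes. -/
theorem isUnit_natCast_of_isNilpotent {p n : ℕ} (hp : IsNilpotent (p : k)) (h : n.Coprime p) :
    IsUnit (n : k) := by
  have h1 := (Nat.isCoprime_iff_coprime.mpr h).map (Int.castRingHom k)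
  simp only [map_natCast] at h1
  obtain ⟨e, he⟩ := hp
  have h2 := h1.pow_right (n := e)
  rwa [he, isCoprime_zero_right] at h2

/-- Factor by factor, the roots differ by `lam i - lam j + n`: this is `n`, prime to `p`, if the
roots agree, and a unit by hypothesis otherwise. -/
theorem isCoprime_polyShift_pow {p : ℕ} (hp : p.Prime) (hnil : IsNilpotent (p : k))
    {m : ℕ} (lam : Fin m → k)
    (hlam : ∀ i j : Fin m, lam i ≠ lam j → ∀ n : ℤ, IsUnit (lam i - lam j - (n : k)))
    {n : ℕ} (hn : 0 < n) (hnp : n < p) :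
    IsCoprime (∏ i, (X - C (lam i))) ((polyShift k ^ n) (∏ i, (X - C (lam i)))) := by
  rw [polyShift_pow_apply, ← coe_compRingHom_apply, map_prod]
  refine IsCoprime.prod_left fun i _ => IsCoprime.prod_right fun j _ => ?_
  rw [coe_compRingHom_apply, sub_comp, X_comp, C_comp,
    show X + C (n : k) - C (lam j) = X - C (lam j - n) by rw [C_sub]; ring]
  apply isCoprime_X_sub_C_of_isUnit_sub
  by_cases h : lam i = lam j
  · rw [h, sub_sub_cancel]
    exact isUnit_natCast_of_isNilpotent hnil
      (Nat.coprime_of_lt_prime hn.ne' hnp hp).symm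
  · simpa [sub_sub_eq_add_sub, sub_add_eq_add_sub] using hlam i j h (-n)

end PolyShift

/-! ### Powers of `x` and `y`, and how they move torsion -/

namespace GWA

section Powers

variable {R : Type u} [CommRing R] {φ : RingAut R} {z : R}

theorem inv_pow_apply_pow_apply (i : ℕ) (r : R) : (φ⁻¹ ^ i) ((φ ^ i) r) = r := by
  rw [← RingAut.mul_apply, inv_pow, inv_mul_cancel, RingAut.one_apply]

theorem pow_apply_inv_pow_apply (i : ℕ) (r : R) : (φ ^ i) ((φ⁻¹ ^ i) r) = r := by
  rw [← RingAut.mul_apply, inv_pow, mul_inv_cancel, RingAut.one_apply]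

theorem inv_pow_succ_apply (i : ℕ) (r : R) : (φ⁻¹ ^ (i + 1)) r = (φ⁻¹ ^ i) (φ.symm r) := by
  rw [pow_succ, RingAut.mul_apply]
  rfl

theorem inv_pow_succ_apply_apply (i : ℕ) (r : R) : (φ⁻¹ ^ (i + 1)) (φ r) = (φ⁻¹ ^ i) r := by
  rw [inv_pow_succ_apply, RingEquiv.symm_apply_apply]

theorem symm_pow_succ_apply (i : ℕ) (r : R) : (φ ^ (i + 1)).symm r = (φ⁻¹ ^ i) (φ.symm r) := by
  rw [← inv_pow_succ_apply, inv_pow]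
  rfl

theorem pow_succ_apply_inv_pow_apply (i : ℕ) (r : R) : (φ ^ (i + 1)) ((φ⁻¹ ^ i) r) = φ r := by
  rw [pow_succ', RingAut.mul_apply, pow_apply_inv_pow_apply]

theorem x_pow_mul_coeff (n : ℕ) (r : R) :
    x φ z ^ n * coeff φ z r = coeff φ z ((φ⁻¹ ^ n) r) * x φ z ^ n := by
  induction n generalizing r with
  | zero => simp
  | succ n ih =>
    rw [pow_succ, mul_assoc, x_mul_coeff, ← mul_assoc, ih, mul_assoc, inv_pow_succ_apply]

theorem y_pow_mul_coeff (n : ℕ) (r : R) :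
    y φ z ^ n * coeff φ z r = coeff φ z ((φ ^ n) r) * y φ z ^ n := by
  induction n generalizing r with
  | zero => simp
  | succ n ih =>
    rw [pow_succ, mul_assoc, y_mul_coeff, ← mul_assoc, ih, mul_assoc, pow_succ φ, RingAut.mul_apply]

theorem y_pow_mul_x_pow (n : ℕ) :
    y φ z ^ n * x φ z ^ n = coeff φ z (∏ j ∈ Finset.range n, (φ ^ j) z) := by
  induction n with
  | zero => simp
  | succ n ih =>
    rw [pow_succ, pow_succ', mul_assoc, ← mul_assoc (y φ z), y_mul_x, ← mul_assoc,
      y_pow_mul_coeff, mul_assoc, ih, ← map_mul, Finset.prod_range_succ, mul_comm]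

theorem x_pow_mul_y_pow (n : ℕ) :
    x φ z ^ n * y φ z ^ n = coeff φ z (∏ j ∈ Finset.range n, (φ⁻¹ ^ (j + 1)) z) := by
  induction n with
  | zero => simp
  | succ n ih =>
    rw [pow_succ, pow_succ', mul_assoc, ← mul_assoc (x φ z), x_mul_y, ← mul_assoc,
      x_pow_mul_coeff, mul_assoc, ih, ← map_mul, Finset.prod_range_succ, mul_comm, inv_pow_succ_apply]

end Powers

section Torsion

variable {R : Type u} [CommRing R] (φ : RingAut R) (z : R)

/-- The underlying `R`-module of an `H(R, φ, z)`-module. -/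
noncomputable abbrev baseModule (M : Type*) [AddCommGroup M] [Module (GWA φ z) M] : Module R M :=
  Module.compHom M (coeff φ z)

/-- The element `m` is killed by a power of `a`. -/
def IsPowTorsion {M : Type*} [AddCommGroup M] [Module (GWA φ z) M] (a : R) (m : M) : Prop :=
  ∃ e : ℕ, coeff φ z (a ^ e) • m = 0

variable {φ z} {M : Type*} [AddCommGroup M] [Module (GWA φ z) M]

theorem IsPowTorsion.eq_zero {a b : R} {m : M} (hm : IsPowTorsion φ z b m) (h : IsCoprime a b)
    (ha : coeff φ z a • m = 0) : m = 0 :=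
  letI := baseModule φ z M
  eq_zero_of_smul_eq_zero_of_isCoprime h ha hm

theorem IsPowTorsion.exists_smul_eq {a b : R} {m : M} (hm : IsPowTorsion φ z b m)
    (h : IsCoprime a b) : ∃ c : R, coeff φ z (c * a) • m = m :=
  letI := baseModule φ z M
  exists_smul_eq_of_isCoprime h hm

theorem IsPowTorsion.of_isNilpotent_sub {a b : R} {m : M} (hm : IsPowTorsion φ z a m)
    (h : IsNilpotent (a - b)) : IsPowTorsion φ z b m :=
  letI := baseModule φ z M
  exists_pow_smul_eq_zero_of_isNilpotent_sub h hm

theorem IsPowTorsion.coeff_smul {a : R} {m : M} (hm : IsPowTorsion φ z a m) (r : R) :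
    IsPowTorsion φ z a (coeff φ z r • m) := by
  obtain ⟨e, he⟩ := hm
  exact ⟨e, by rw [smul_smul, ← map_mul, mul_comm, map_mul, mul_smul, he, smul_zero]⟩

theorem IsPowTorsion.x_pow_smul {a : R} {m : M} (hm : IsPowTorsion φ z a m) (n : ℕ) :
    IsPowTorsion φ z ((φ⁻¹ ^ n) a) (x φ z ^ n • m) := by
  obtain ⟨e, he⟩ := hm
  exact ⟨e, by rw [smul_smul, ← map_pow, ← x_pow_mul_coeff, mul_smul, he, smul_zero]⟩

theorem IsPowTorsion.y_pow_smul {a : R} {m : M} (hm : IsPowTorsion φ z a m) (n : ℕ) :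
    IsPowTorsion φ z ((φ ^ n) a) (y φ z ^ n • m) := by
  obtain ⟨e, he⟩ := hm
  exact ⟨e, by rw [smul_smul, ← map_pow, ← y_pow_mul_coeff, mul_smul, he, smul_zero]⟩

theorem IsPowTorsion.map {M' : Type*} [AddCommGroup M'] [Module (GWA φ z) M'] {a : R} {m : M}
    (hm : IsPowTorsion φ z a m) (f : M →ₗ[GWA φ z] M') : IsPowTorsion φ z a (f m) := by
  obtain ⟨e, he⟩ := hm
  exact ⟨e, by rw [← map_smul, he, map_zero]⟩

/-- The `a`-power torsion elements. -/
def powTorsion (φ : RingAut R) (z a : R) (M : Type*) [AddCommGroup M] [Module (GWA φ z) M] :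
    AddSubgroup M where
  carrier := {m | IsPowTorsion φ z a m}
  zero_mem' := ⟨0, smul_zero _⟩
  add_mem' := by
    rintro m n ⟨d, hd⟩ ⟨e, he⟩
    refine ⟨d + e, ?_⟩
    rw [smul_add, pow_add, map_mul, mul_smul _ _ n, he, smul_zero, ← map_mul, mul_comm, map_mul,
      mul_smul, hd, smul_zero, add_zero]
  neg_mem' := by
    rintro m ⟨e, he⟩
    exact ⟨e, by rw [smul_neg, he, neg_zero]⟩

end Torsion

/-! ### Coprimality of the translates of `z` -/

section Coprime

variable {R : Type u} [CommRing R] {φ : RingAut R} {z : R} {q : ℕ}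

theorem isCoprime_pow_apply (h : ∀ i, 0 < i → i ≤ q → IsCoprime z ((φ ^ i) z)) {i j : ℕ}
    (hi : i ≤ q) (hj : j ≤ q) (hij : i ≠ j) : IsCoprime ((φ ^ i) z) ((φ ^ j) z) := by
  wlog hlt : i < j generalizing i j
  · exact (this hj hi hij.symm (by omega)).symm
  have := (h (j - i) (by omega) (by omega)).map (RingEquiv.toRingHom (φ ^ i))
  change IsCoprime ((φ ^ i) z) ((φ ^ i) ((φ ^ (j - i)) z)) at this
  rwa [← RingAut.mul_apply, ← pow_add, Nat.add_sub_cancel' hlt.le] at this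

theorem isCoprime_inv_pow_apply_pow_apply (h : ∀ i, 0 < i → i ≤ q → IsCoprime z ((φ ^ i) z))
    {i j : ℕ} (hi : i ≤ q) (hj : j ≤ q) (hij : i ≠ j) :
    IsCoprime ((φ⁻¹ ^ j) ((φ ^ i) z)) z := by
  have := (isCoprime_pow_apply h hi hj hij).map (RingEquiv.toRingHom (φ⁻¹ ^ j))
  change IsCoprime ((φ⁻¹ ^ j) ((φ ^ i) z)) ((φ⁻¹ ^ j) ((φ ^ j) z)) at this
  rwa [inv_pow_apply_pow_apply] at this

/-- The product is `x ^ n * y ^ n`, so `y ^ n` will be injective on `z`-power torsion. -/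
theorem isCoprime_prod_inv_pow (h : ∀ i, 0 < i → i ≤ q → IsCoprime z ((φ ^ i) z)) {n : ℕ}
    (hn : n ≤ q) : IsCoprime (∏ j ∈ Finset.range n, (φ⁻¹ ^ (j + 1)) z) z := by
  refine IsCoprime.prod_left fun j hj => ?_
  rw [Finset.mem_range] at hj
  simpa using isCoprime_inv_pow_apply_pow_apply h (Nat.zero_le q)
    (show j + 1 ≤ q by omega) (by omega)

/-- The product is `y ^ n * x ^ n`, so `y ^ n` will map onto the `φ ^ n z`-power torsion. -/
theorem isCoprime_prod_pow (h : ∀ i, 0 < i → i ≤ q → IsCoprime z ((φ ^ i) z)) {n : ℕ}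
    (hn : n ≤ q) : IsCoprime (∏ j ∈ Finset.range n, (φ ^ j) z) ((φ ^ n) z) := by
  refine IsCoprime.prod_left fun j hj => ?_
  rw [Finset.mem_range] at hj
  exact isCoprime_pow_apply h (by omega) hn (by omega)

theorem isNilpotent_pow_mul_apply_sub {p : ℕ} (h : ∀ r, IsNilpotent ((φ ^ p) r - r)) (n : ℕ)
    (r : R) : IsNilpotent ((φ ^ (p * n)) r - r) := by
  induction n with
  | zero => simp
  | succ n ih =>
    rw [mul_add_one, add_comm, pow_add, RingAut.mul_apply]
    have := (Commute.all _ _).isNilpotent_add (h ((φ ^ (p * n)) r)) ih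
    rwa [sub_add_sub_cancel] at this

end Coprime

end GWA

/-! ### The induced module -/

namespace GWA

section Induced

variable {R : Type u} [CommRing R] (φ : RingAut R) (z : R) (q : ℕ)

/-- The module over `H(R, φ, z)` induced from a module `N` over `H(R, φ ^ (q + 1), z)`: it consists
of `q + 1` copies of `N`, where `y` moves each copy identically to the next one. -/
def Induced (N : Type*) : Type _ := Fin (q + 1) → N

variable {N : Type*} [AddCommGroup N] [Module (GWA (φ ^ (q + 1)) z) N]

noncomputable instance : AddCommGroup (Induced q N) :=
  inferInstanceAs (AddCommGroup (Fin (q + 1) → N))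

variable {φ z q}

variable (φ z) in
/-- The action of `R` on the induced module. -/
noncomputable def inducedCoeff (r : R) : Induced q N →+ Induced q N where
  toFun n i := coeff (φ ^ (q + 1)) z ((φ⁻¹ ^ (i : ℕ)) r) • n i
  map_zero' := by funext i; exact smul_zero _
  map_add' _ _ := by funext i; exact smul_add _ _ _

/-- Copy `i` stands for `y ^ i N`, and `r y ^ i = y ^ i φ⁻ⁱ(r)`, whence the twist. -/
theorem inducedCoeff_apply (r : R) (n : Induced q N) (i : Fin (q + 1)) :
    inducedCoeff φ z r n i = coeff (φ ^ (q + 1)) z ((φ⁻¹ ^ (i : ℕ)) r) • n i := rfl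

variable (φ z) in
/-- The action of `x` on the elements of the induced module. -/
noncomputable def inducedXFun (n : Induced q N) : Induced q N :=
  Fin.snoc (α := fun _ => N)
    (fun i : Fin q => coeff (φ ^ (q + 1)) z ((φ⁻¹ ^ (i + 1 : ℕ)) z) • n i.succ)
    (x (φ ^ (q + 1)) z • n 0)

theorem inducedXFun_last (n : Induced q N) :
    inducedXFun φ z n (Fin.last q) = x (φ ^ (q + 1)) z • n 0 :=
  Fin.snoc_last (α := fun _ => N) _ _

/-- The coefficient is forced by `x y ^ (i + 1) = φ⁻¹(z) y ^ i = y ^ i φ^{-(i + 1)}(z)`. -/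
theorem inducedXFun_castSucc (n : Induced q N) (i : Fin q) :
    inducedXFun φ z n i.castSucc =
      coeff (φ ^ (q + 1)) z ((φ⁻¹ ^ (i + 1 : ℕ)) z) • n i.succ :=
  Fin.snoc_castSucc (α := fun _ => N) _ _ i

theorem add_induced_apply (m n : Induced q N) (i : Fin (q + 1)) : (m + n) i = m i + n i := rfl

theorem zero_induced_apply (i : Fin (q + 1)) : (0 : Induced q N) i = 0 := rfl

variable (φ z) in
/-- The action of `x` on the induced module. -/
noncomputable def inducedX : Induced q N →+ Induced q N where
  toFun := inducedXFun φ z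
  map_zero' := by
    funext i
    cases i using Fin.lastCases <;>
    simp only [inducedXFun_last, inducedXFun_castSucc, zero_induced_apply, smul_zero]
  map_add' m n := by
    funext i
    cases i using Fin.lastCases <;>
    simp only [inducedXFun_last, inducedXFun_castSucc, add_induced_apply, smul_add]

theorem inducedX_last (n : Induced q N) :
    inducedX φ z n (Fin.last q) = x (φ ^ (q + 1)) z • n 0 :=
  inducedXFun_last n

theorem inducedX_castSucc (n : Induced q N) (i : Fin q) :
    inducedX φ z n i.castSucc = coeff (φ ^ (q + 1)) z ((φ⁻¹ ^ (i + 1 : ℕ)) z) • n i.succ :=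
  inducedXFun_castSucc n i

variable (φ z) in
/-- The action of `y` on the induced module. -/
noncomputable def inducedY : Induced q N →+ Induced q N where
  toFun n := Fin.cons (α := fun _ => N)
    (y (φ ^ (q + 1)) z • n (Fin.last q)) (fun i : Fin q => n i.castSucc)
  map_zero' := by
    funext i
    cases i using Fin.cases with
    | zero => exact smul_zero _
    | succ i => rfl
  map_add' m n := by
    funext i
    cases i using Fin.cases with
    | zero => exact smul_add _ _ _
    | succ i => rfl

theorem inducedY_zero (n : Induced q N) :
    inducedY φ z n 0 = y (φ ^ (q + 1)) z • n (Fin.last q) := rfl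

theorem inducedY_succ (n : Induced q N) (i : Fin q) : inducedY φ z n i.succ = n i.castSucc := rfl

variable (φ z q N) in
/-- The action of `H(R, φ, z)` on the induced module. -/
noncomputable def inducedAction : ActionData φ z (Induced q N) where
  c := inducedCoeff φ z
  X := inducedX φ z
  Y := inducedY φ z
  c_one n := by
    funext i
    rw [inducedCoeff_apply, map_one, map_one, one_smul]
  c_add r s n := by
    funext i
    simp only [add_induced_apply, inducedCoeff_apply, map_add, add_smul]
  c_mul r s n := by
    funext i
    simp only [inducedCoeff_apply, map_mul, mul_smul]
  yx n := by
    funext i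
    cases i using Fin.cases with
    | zero => simp [inducedY_zero, inducedX_last, inducedCoeff_apply, smul_smul, y_mul_x]
    | succ i => rw [inducedY_succ, inducedX_castSucc, inducedCoeff_apply, Fin.val_succ]
  xy n := by
    funext i
    rw [inducedCoeff_apply, ← inv_pow_succ_apply]
    cases i using Fin.lastCases with
    | last =>
      -- Around the end of the cycle, the relation becomes `xy = (φ ^ (q + 1))⁻¹(z)` in `H(R, φ ^ (q
      -- + 1), z)`.
      rw [inducedX_last, inducedY_zero, smul_smul, x_mul_y, Fin.val_last, symm_pow_succ_apply,
        inv_pow_succ_apply]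
    | cast i => rw [inducedX_castSucc, inducedY_succ, Fin.val_castSucc]
  xc r n := by
    funext i
    rw [inducedCoeff_apply, ← inv_pow_succ_apply]
    cases i using Fin.lastCases with
    | last =>
      simp only [inducedX_last, inducedCoeff_apply, smul_smul, x_mul_coeff, Fin.val_last,
        symm_pow_succ_apply, inv_pow_succ_apply, Fin.val_zero, pow_zero, RingAut.one_apply]
    | cast i =>
      rw [inducedX_castSucc, inducedX_castSucc, inducedCoeff_apply, smul_smul, smul_smul,
        ← map_mul, ← map_mul, mul_comm, Fin.val_succ, Fin.val_castSucc]
  yc r n := by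
    funext i
    cases i using Fin.cases with
    | zero =>
      simp only [inducedY_zero, inducedCoeff_apply, smul_smul, y_mul_coeff, Fin.val_last,
        Fin.val_zero, pow_zero, RingAut.one_apply, pow_succ_apply_inv_pow_apply]
    | succ i =>
      rw [inducedY_succ, inducedCoeff_apply, inducedCoeff_apply, inducedY_succ, Fin.val_succ,
        Fin.val_castSucc, inv_pow_succ_apply_apply]

noncomputable instance : Module (GWA φ z) (Induced q N) :=
  (inducedAction φ z q N).toModule

theorem induced_coeff_smul (r : R) (n : Induced q N) (i : Fin (q + 1)) :
    (coeff φ z r • n) i = coeff (φ ^ (q + 1)) z ((φ⁻¹ ^ (i : ℕ)) r) • n i :=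
  congrFun ((inducedAction φ z q N).coeff_smul r n) i

theorem induced_x_smul_last (n : Induced q N) :
    (x φ z • n) (Fin.last q) = x (φ ^ (q + 1)) z • n 0 :=
  (congrFun ((inducedAction φ z q N).x_smul n) _).trans (inducedX_last n)

theorem induced_x_smul_castSucc (n : Induced q N) (i : Fin q) :
    (x φ z • n) i.castSucc = coeff (φ ^ (q + 1)) z ((φ⁻¹ ^ (i + 1 : ℕ)) z) • n i.succ :=
  (congrFun ((inducedAction φ z q N).x_smul n) _).trans (inducedX_castSucc n i)

theorem induced_y_smul_zero (n : Induced q N) :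
    (y φ z • n) 0 = y (φ ^ (q + 1)) z • n (Fin.last q) :=
  congrFun ((inducedAction φ z q N).y_smul n) _

theorem induced_y_smul_succ (n : Induced q N) (i : Fin q) : (y φ z • n) i.succ = n i.castSucc :=
  congrFun ((inducedAction φ z q N).y_smul n) _

variable (q) in
/-- The inclusion of the `i`-th copy of `N` in the induced module. -/
def single (i : Fin (q + 1)) : N →+ Induced q N := AddMonoidHom.single (fun _ => N) i

theorem single_same (i : Fin (q + 1)) (n : N) : single q i n i = n :=
  Pi.single_eq_same (M := fun _ => N) i n

theorem single_of_ne {i j : Fin (q + 1)} (h : j ≠ i) (n : N) : single q i n j = 0 :=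
  Pi.single_eq_of_ne (M := fun _ => N) h n

theorem sum_single (n : Induced q N) : ∑ i, single q i (n i) = n :=
  Finset.univ_sum_single (M := fun _ => N) n

theorem eq_single {n : Induced q N} {i : Fin (q + 1)} (h : ∀ j, j ≠ i → n j = 0) :
    n = single q i (n i) := by
  funext j
  by_cases hj : j = i
  · rw [hj, single_same]
  · rw [h j hj, single_of_ne hj]

theorem coeff_smul_single (r : R) (i : Fin (q + 1)) (n : N) :
    coeff φ z r • single q i n =
      single q i (coeff (φ ^ (q + 1)) z ((φ⁻¹ ^ (i : ℕ)) r) • n) := by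
  rw [eq_single (n := coeff φ z r • single q i n) (i := i), induced_coeff_smul, single_same]
  intro j hj
  rw [induced_coeff_smul, single_of_ne hj, smul_zero]

theorem x_smul_single_zero (n : N) :
    x φ z • single q 0 n = single q (Fin.last q) (x (φ ^ (q + 1)) z • n) := by
  rw [eq_single (n := x φ z • single q 0 n) (i := Fin.last q), induced_x_smul_last,
    single_same]
  intro j hj
  obtain ⟨j, rfl⟩ := Fin.exists_castSucc_eq.mpr hj
  rw [induced_x_smul_castSucc, single_of_ne (Fin.succ_ne_zero j), smul_zero]

theorem x_smul_single_succ (i : Fin q) (n : N) :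
    x φ z • single q i.succ n =
      single q i.castSucc (coeff (φ ^ (q + 1)) z ((φ⁻¹ ^ (i + 1 : ℕ)) z) • n) := by
  rw [eq_single (n := x φ z • single q i.succ n) (i := i.castSucc), induced_x_smul_castSucc, single_same]
  intro j hj
  cases j using Fin.lastCases with
  | last => rw [induced_x_smul_last, single_of_ne (Fin.succ_ne_zero i).symm, smul_zero]
  | cast j =>
    rw [induced_x_smul_castSucc, single_of_ne, smul_zero]
    rintro h
    exact hj (congrArg _ (Fin.succ_injective _ h))

theorem y_smul_single_last (n : N) :
    y φ z • single q (Fin.last q) n = single q 0 (y (φ ^ (q + 1)) z • n) := by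
  rw [eq_single (n := y φ z • single q (Fin.last q) n) (i := 0), induced_y_smul_zero,
    single_same]
  intro j hj
  obtain ⟨j, rfl⟩ := Fin.exists_succ_eq.mpr hj
  rw [induced_y_smul_succ, single_of_ne (Fin.castSucc_lt_last j).ne]

theorem y_smul_single_castSucc (i : Fin q) (n : N) :
    y φ z • single q i.castSucc n = single q i.succ n := by
  rw [eq_single (n := y φ z • single q i.castSucc n) (i := i.succ), induced_y_smul_succ,
    single_same]
  intro j hj
  cases j using Fin.cases with
  | zero => rw [induced_y_smul_zero, single_of_ne (Fin.castSucc_lt_last i).ne', smul_zero]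
  | succ j =>
    rw [induced_y_smul_succ, single_of_ne]
    rintro h
    exact hj (congrArg _ (Fin.castSucc_injective _ h))

theorem y_pow_smul_single_zero (i : Fin (q + 1)) (n : N) :
    y φ z ^ (i : ℕ) • single q 0 n = single q i n := by
  induction i using Fin.induction with
  | zero => simp
  | succ i ih =>
    rw [Fin.val_succ, pow_succ', mul_smul, ← Fin.val_castSucc, ih, y_smul_single_castSucc]

theorem y_pow_succ_smul_single_zero (n : N) :
    y φ z ^ (q + 1) • single q 0 n = single q 0 (y (φ ^ (q + 1)) z • n) := by
  have h := y_pow_smul_single_zero (φ := φ) (z := z) (Fin.last q) n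
  rw [Fin.val_last] at h
  rw [pow_succ', mul_smul, h, y_smul_single_last]

variable {N' : Type*} [AddCommGroup N'] [Module (GWA (φ ^ (q + 1)) z) N']

/-- The map of induced modules attached to a linear map. -/
noncomputable def inducedMap (f : N →ₗ[GWA (φ ^ (q + 1)) z] N') :
    Induced q N →ₗ[GWA φ z] Induced q N' :=
  linearMapMk
    { toFun n i := f (n i)
      map_zero' := by funext i; exact map_zero f
      map_add' m n := by funext i; exact map_add f (m i) (n i) }
    (fun r n => by
      funext i
      exact (congrArg f (induced_coeff_smul r n i)).trans
        ((map_smul f _ _).trans (induced_coeff_smul r (N := N') (fun i => f (n i)) i).symm))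
    (fun n => by
      funext i
      cases i using Fin.lastCases with
      | last =>
        rw [induced_x_smul_last]
        exact (congrArg f (induced_x_smul_last n)).trans (map_smul f _ _)
      | cast i =>
        rw [induced_x_smul_castSucc]
        exact (congrArg f (induced_x_smul_castSucc n i)).trans (map_smul f _ _))
    (fun n => by
      funext i
      cases i using Fin.cases with
      | zero =>
        rw [induced_y_smul_zero]
        exact (congrArg f (induced_y_smul_zero n)).trans (map_smul f _ _)
      | succ i =>
        rw [induced_y_smul_succ]
        exact congrArg f (induced_y_smul_succ n i))

theorem inducedMap_apply (f : N →ₗ[GWA (φ ^ (q + 1)) z] N') (n : Induced q N) (i : Fin (q + 1)) :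
    inducedMap f n i = f (n i) := rfl

theorem inducedMap_single (f : N →ₗ[GWA (φ ^ (q + 1)) z] N') (n : N) (i : Fin (q + 1)) :
    inducedMap f (single q i n) = single q i (f n) := by
  rw [eq_single (n := inducedMap f (single q i n)) (i := i), inducedMap_apply, single_same]
  intro j hj
  rw [inducedMap_apply, single_of_ne hj, map_zero]

end Induced

end GWA

/-! ### Local nilpotence of `x` implies power torsion -/

namespace GWA

section LocallyNilpotent

variable {R : Type u} [CommRing R] {φ : RingAut R} {z : R}

theorem isNilpotent_mul_sub_mul {a b c d : R} (h : IsNilpotent (a - b)) (h' : IsNilpotent (c - d)) :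
    IsNilpotent (a * c - b * d) := by
  rw [show a * c - b * d = (a - b) * c + b * (c - d) by ring]
  exact (Commute.all _ _).isNilpotent_add ((Commute.all _ _).isNilpotent_mul_right h)
    ((Commute.all _ _).isNilpotent_mul_left h')

theorem isNilpotent_prod_sub_prod {a b : ℕ → R} (h : ∀ i, IsNilpotent (a i - b i)) (n : ℕ) :
    IsNilpotent (∏ i ∈ Finset.range n, a i - ∏ i ∈ Finset.range n, b i) := by
  induction n with
  | zero => simp
  | succ n ih =>
    rw [Finset.prod_range_succ, Finset.prod_range_succ]
    exact isNilpotent_mul_sub_mul ih (h n)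

/-- Modulo nilpotents, each block of `p` consecutive factors equals the first block. -/
theorem isNilpotent_prod_pow_apply_sub {p : ℕ} (h : ∀ r, IsNilpotent ((φ ^ p) r - r)) (n : ℕ) :
    IsNilpotent (∏ j ∈ Finset.range (p * n), (φ ^ j) z -
      (∏ j ∈ Finset.range p, (φ ^ j) z) ^ n) := by
  induction n with
  | zero => simp
  | succ n ih =>
    rw [mul_add_one, Finset.prod_range_add, pow_succ]
    refine isNilpotent_mul_sub_mul ih (isNilpotent_prod_sub_prod (fun i => ?_) p)
    rw [pow_add, RingAut.mul_apply]
    exact isNilpotent_pow_mul_apply_sub h n _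

variable {M : Type*} [AddCommGroup M] [Module (GWA φ z) M]

theorem x_pow_smul_eq_zero_of_le {m : M} {k n : ℕ} (h : x φ z ^ k • m = 0) (hkn : k ≤ n) :
    x φ z ^ n • m = 0 := by
  rw [← Nat.sub_add_cancel hkn, pow_add, mul_smul, h, smul_zero]

theorem isPowTorsion_prod_of_x_pow_smul_eq_zero {p : ℕ} (hp : 0 < p)
    (h : ∀ r, IsNilpotent ((φ ^ p) r - r)) {m : M} {n : ℕ} (hm : x φ z ^ n • m = 0) :
    IsPowTorsion φ z (∏ j ∈ Finset.range p, (φ ^ j) z) m := by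
  have h1 : IsPowTorsion φ z (∏ j ∈ Finset.range (p * n), (φ ^ j) z) m :=
    -- The exponent `n` is enlarged to `p * n` so that the product consists of whole periods.
    ⟨1, by rw [pow_one, ← y_pow_mul_x_pow, mul_smul,
      x_pow_smul_eq_zero_of_le hm (Nat.le_mul_of_pos_left n hp), smul_zero]⟩
  obtain ⟨e, he⟩ := h1.of_isNilpotent_sub (isNilpotent_prod_pow_apply_sub h n)
  exact ⟨n * e, by rwa [pow_mul]⟩

/-- The case of period one; it is applied to `φ ^ (q + 1)` in place of `φ`. -/
theorem isPowTorsion_of_x_pow_smul_eq_zero (h : ∀ r, IsNilpotent (φ r - r)) {m : M} {n : ℕ}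
    (hm : x φ z ^ n • m = 0) : IsPowTorsion φ z z m := by
  simpa using isPowTorsion_prod_of_x_pow_smul_eq_zero one_pos (by simpa using h) hm

variable (φ z M) in
/-- The elements killed by a power of `x`. -/
def xTorsion : AddSubmonoid M where
  carrier := {m | ∃ n : ℕ, x φ z ^ n • m = 0}
  zero_mem' := ⟨0, smul_zero _⟩
  add_mem' := by
    rintro m n ⟨d, hd⟩ ⟨e, he⟩
    exact ⟨max d e, by rw [smul_add, x_pow_smul_eq_zero_of_le hd (le_max_left _ _),
      x_pow_smul_eq_zero_of_le he (le_max_right _ _), add_zero]⟩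

theorem mem_xTorsion_of_x_smul_mem {m : M} (h : x φ z • m ∈ xTorsion φ z M) :
    m ∈ xTorsion φ z M := by
  obtain ⟨n, hn⟩ := h
  exact ⟨n + 1, by rwa [pow_succ, mul_smul]⟩

end LocallyNilpotent

/-! ### Induction preserves `𝒪` and is fully faithful -/

section FullyFaithful

variable {R : Type u} [CommRing R] {φ : RingAut R} {z : R} {q : ℕ}
variable {N : Type*} [AddCommGroup N] [Module (GWA (φ ^ (q + 1)) z) N]
variable {N' : Type*} [AddCommGroup N'] [Module (GWA (φ ^ (q + 1)) z) N']

/-- `x` descends through the copies, multiplying by coefficients, which preserves `h`; each passage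
from copy `0` to the last one applies the inner `x` and lowers `k`. -/
theorem single_mem_xTorsion {k : ℕ} {n : N} (h : x (φ ^ (q + 1)) z ^ k • n = 0)
    (i : Fin (q + 1)) : single q i n ∈ xTorsion φ z (Induced q N) := by
  induction k generalizing n i with
  | zero =>
    rw [pow_zero, one_smul] at h
    rw [h, map_zero]
    exact zero_mem _
  | succ k ih =>
    induction i using Fin.induction generalizing n with
    | zero =>
      apply mem_xTorsion_of_x_smul_mem
      rw [x_smul_single_zero]
      exact ih (by rwa [smul_smul, ← pow_succ]) _
    | succ i hi =>
      apply mem_xTorsion_of_x_smul_mem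
      rw [x_smul_single_succ]
      exact hi (by rw [smul_smul, x_pow_mul_coeff, mul_smul, h, smul_zero])

theorem induced_locally_nilpotent (h : ∀ n : N, ∃ k : ℕ, x (φ ^ (q + 1)) z ^ k • n = 0)
    (n : Induced q N) : ∃ k : ℕ, x φ z ^ k • n = 0 := by
  change n ∈ xTorsion φ z (Induced q N)
  rw [← sum_single n]
  refine sum_mem fun i _ => ?_
  obtain ⟨k, hk⟩ := h (n i)
  exact single_mem_xTorsion hk i

theorem isPowTorsion_single {n : N} (h : IsPowTorsion (φ ^ (q + 1)) z z n) (i : Fin (q + 1)) :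
    IsPowTorsion φ z ((φ ^ (i : ℕ)) z) (single q i n) := by
  obtain ⟨e, he⟩ := h
  exact ⟨e, by rw [coeff_smul_single, map_pow, inv_pow_apply_pow_apply, he, map_zero]⟩

/-- On copy `j ≠ i`, a power of `φ ^ i z` acts through an element coprime to `z`, hence injectively.
-/
theorem eq_single_of_isPowTorsion (hN : ∀ n : N, IsPowTorsion (φ ^ (q + 1)) z z n)
    (hz : ∀ i, 0 < i → i ≤ q → IsCoprime z ((φ ^ i) z)) {n : Induced q N} {i : Fin (q + 1)}
    (h : IsPowTorsion φ z ((φ ^ (i : ℕ)) z) n) : n = single q i (n i) := by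
  refine eq_single fun j hj => ?_
  obtain ⟨e, he⟩ := h
  have h1 := congrFun he j
  rw [induced_coeff_smul, map_pow] at h1
  exact (hN (n j)).eq_zero (IsCoprime.pow_left (isCoprime_inv_pow_apply_pow_apply hz
    (Nat.lt_succ_iff.mp i.2) (Nat.lt_succ_iff.mp j.2) (Fin.val_ne_of_ne hj.symm))) h1

theorem inducedMap_injective :
    Function.Injective
      (inducedMap : (N →ₗ[GWA (φ ^ (q + 1)) z] N') → (Induced q N →ₗ[GWA φ z] Induced q N')) := by
  intro f g h
  ext n
  have := congrArg (fun F => F (single q 0 n) 0) h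
  simpa only [inducedMap_single, single_same] using this

/-- A linear map preserves `z`-power torsion, hence copy `0`; commuting with `y`, it is then the
same map `g` on every copy. -/
theorem inducedMap_surjective (hN : ∀ n : N, IsPowTorsion (φ ^ (q + 1)) z z n)
    (hN' : ∀ n : N', IsPowTorsion (φ ^ (q + 1)) z z n)
    (hz : ∀ i, 0 < i → i ≤ q → IsCoprime z ((φ ^ i) z)) :
    Function.Surjective
      (inducedMap : (N →ₗ[GWA (φ ^ (q + 1)) z] N') → (Induced q N →ₗ[GWA φ z] Induced q N')) := by
  intro f
  let g : N →+ N' :=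
    { toFun n := f (single q 0 n) 0
      map_zero' := by rw [map_zero, map_zero]; rfl
      map_add' m n := by rw [map_add, map_add]; rfl }
  have hg0 (n : N) : f (single q 0 n) = single q 0 (g n) :=
    eq_single_of_isPowTorsion hN' hz ((isPowTorsion_single (hN n) 0).map f)
  have hg (i : Fin (q + 1)) (n : N) : f (single q i n) = single q i (g n) := by
    rw [← y_pow_smul_single_zero (φ := φ) (z := z), map_smul, hg0, y_pow_smul_single_zero]
  have hinj {i : Fin (q + 1)} {m n : N'} (h : single q i m = single q i n) : m = n := by
    rw [← single_same i m, h, single_same]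
  -- The outer `x` realizes the inner one from copy `0` to the last copy, so linearity in `x` is
  -- tested there; `y ^ (q + 1)` realizes the inner `y` on copy `0`.
  refine ⟨linearMapMk (φ := φ ^ (q + 1)) (z := z) g (fun r n => hinj (i := 0) ?_) (fun n => hinj (i := Fin.last q) ?_)
    (fun n => hinj (i := 0) ?_), LinearMap.ext fun n => ?_⟩
  · have := coeff_smul_single (φ := φ) (z := z) (q := q) r 0 n
    rw [Fin.val_zero, pow_zero, RingAut.one_apply] at this
    rw [← hg, ← this, map_smul, hg, coeff_smul_single, Fin.val_zero, pow_zero, RingAut.one_apply]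
  · rw [← hg, ← x_smul_single_zero, ← x_smul_single_zero, map_smul, hg]
  · rw [← hg, ← y_pow_succ_smul_single_zero, ← y_pow_succ_smul_single_zero, map_smul, hg]
  · rw [← sum_single n, map_sum, map_sum]
    refine Finset.sum_congr rfl fun i _ => ?_
    rw [inducedMap_single, hg]
    rfl

end FullyFaithful

/-! ### Recovering a module from its `z`-power torsion -/

section EssentiallySurjective

variable {R : Type u} [CommRing R] {φ : RingAut R} {z : R} {q : ℕ}
variable {M : Type*} [AddCommGroup M] [Module (GWA φ z) M]

theorem eq_zero_of_y_pow_smul_eq_zero (hz : ∀ i, 0 < i → i ≤ q → IsCoprime z ((φ ^ i) z))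
    {i : ℕ} (hi : i ≤ q) {m : M} (hm : IsPowTorsion φ z z m) (h : y φ z ^ i • m = 0) : m = 0 :=
  hm.eq_zero (isCoprime_prod_inv_pow hz hi) (by rw [← x_pow_mul_y_pow, mul_smul, h, smul_zero])

theorem exists_y_pow_smul_eq (hz : ∀ i, 0 < i → i ≤ q → IsCoprime z ((φ ^ i) z))
    {i : ℕ} (hi : i ≤ q) {m : M} (hm : IsPowTorsion φ z ((φ ^ i) z) m) :
    ∃ n : M, IsPowTorsion φ z z n ∧ y φ z ^ i • n = m := by
  obtain ⟨c, hc⟩ := hm.exists_smul_eq (isCoprime_prod_pow hz hi)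
  -- `c` inverts `y ^ i * x ^ i` on `m`.
  refine ⟨x φ z ^ i • coeff φ z c • m, ?_, ?_⟩
  · have := (hm.coeff_smul c).x_pow_smul i
    rwa [inv_pow_apply_pow_apply] at this
  · rw [smul_smul, y_pow_mul_x_pow, smul_smul, ← map_mul, mul_comm, hc]

theorem IsPowTorsion.y_pow_succ_smul (hφ : ∀ r, IsNilpotent ((φ ^ (q + 1)) r - r)) {m : M}
    (hm : IsPowTorsion φ z z m) : IsPowTorsion φ z z (y φ z ^ (q + 1) • m) :=
  (hm.y_pow_smul (q + 1)).of_isNilpotent_sub (hφ z)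

/-- `x` leads to `φ⁻¹ z`-power torsion, and `φ⁻¹ z` agrees with `φ ^ q z` modulo nilpotents. -/
theorem IsPowTorsion.x_smul (hφ : ∀ r, IsNilpotent ((φ ^ (q + 1)) r - r)) {m : M}
    (hm : IsPowTorsion φ z z m) : IsPowTorsion φ z ((φ ^ q) z) (x φ z • m) := by
  have h := hm.x_pow_smul 1
  rw [pow_one, pow_one] at h
  refine h.of_isNilpotent_sub ?_
  rw [← neg_sub, isNilpotent_neg_iff]
  have h1 := hφ (φ⁻¹ z)
  rwa [pow_succ, RingAut.mul_apply, show φ (φ⁻¹ z) = z from φ.apply_symm_apply z] at h1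

/-- `X` is `(y ^ q)⁻¹ x`. Equalities between values of `X` are checked after applying `y ^ q`,
injective on this part. -/
theorem exists_torsion_action (hφ : ∀ r, IsNilpotent ((φ ^ (q + 1)) r - r))
    (hz : ∀ i, 0 < i → i ≤ q → IsCoprime z ((φ ^ i) z)) :
    ∃ D : ActionData (φ ^ (q + 1)) z (powTorsion φ z z M),
      (∀ r n, (D.c r n : M) = coeff φ z r • (n : M)) ∧
      (∀ n, y φ z ^ q • (D.X n : M) = x φ z • (n : M)) ∧
      ∀ n, (D.Y n : M) = y φ z ^ (q + 1) • (n : M) := by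
  have key (n : powTorsion φ z z M) :
      ∃ n' : powTorsion φ z z M, y φ z ^ q • (n' : M) = x φ z • (n : M) := by
    obtain ⟨n', h1, h2⟩ := exists_y_pow_smul_eq hz le_rfl (IsPowTorsion.x_smul hφ n.2)
    exact ⟨⟨n', h1⟩, h2⟩
  choose X hX using key
  have hinj {m n : powTorsion φ z z M} (h : y φ z ^ q • (m : M) = y φ z ^ q • (n : M)) :
      m = n := by
    rw [← sub_eq_zero, ← smul_sub, ← AddSubgroup.coe_sub] at h
    rw [← sub_eq_zero]
    exact Subtype.ext (eq_zero_of_y_pow_smul_eq_zero hz le_rfl (m - n).2 h)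
  refine ⟨
    { c r :=
        { toFun n := ⟨coeff φ z r • (n : M), IsPowTorsion.coeff_smul n.2 r⟩
          map_zero' := Subtype.ext (smul_zero _)
          map_add' m n := Subtype.ext (smul_add _ _ _) }
      X :=
        { toFun := X
          map_zero' := hinj (by rw [hX, AddSubgroup.coe_zero, smul_zero, smul_zero])
          map_add' m n := hinj (by
            rw [hX, AddSubgroup.coe_add, AddSubgroup.coe_add, smul_add, smul_add, hX, hX]) }
      Y :=
        { toFun n := ⟨y φ z ^ (q + 1) • (n : M), IsPowTorsion.y_pow_succ_smul hφ n.2⟩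
          map_zero' := Subtype.ext (smul_zero _)
          map_add' m n := Subtype.ext (smul_add _ _ _) }
      c_one n := Subtype.ext (by simp)
      c_add r s n := Subtype.ext (by simp [add_smul])
      c_mul r s n := Subtype.ext (by simp [mul_smul])
      yx n := Subtype.ext ?_
      xy n := hinj ?_
      xc r n := hinj ?_
      yc r n := Subtype.ext ?_ }, fun _ _ => rfl, hX, fun _ => rfl⟩
  · change y φ z ^ (q + 1) • (X n : M) = coeff φ z z • (n : M)
    rw [pow_succ', mul_smul, hX, smul_smul, y_mul_x]
  · refine (hX _).trans ?_
    change x φ z • y φ z ^ (q + 1) • (n : M) =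
      y φ z ^ q • coeff φ z ((φ ^ (q + 1)).symm z) • (n : M)
    rw [smul_smul, smul_smul, pow_succ', ← mul_assoc, x_mul_y, y_pow_mul_coeff,
      symm_pow_succ_apply, pow_apply_inv_pow_apply]
  · refine (hX _).trans ?_
    change x φ z • coeff φ z r • (n : M) =
      y φ z ^ q • coeff φ z ((φ ^ (q + 1)).symm r) • (X n : M)
    rw [smul_smul, smul_smul, x_mul_coeff, y_pow_mul_coeff, symm_pow_succ_apply,
      pow_apply_inv_pow_apply, mul_smul, mul_smul, hX]
  · change y φ z ^ (q + 1) • coeff φ z r • (n : M) =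
      coeff φ z ((φ ^ (q + 1)) r) • y φ z ^ (q + 1) • (n : M)
    rw [smul_smul, smul_smul, y_pow_mul_coeff]

variable {N : Type*} [AddCommGroup N]

/-- The map `n ↦ ∑ i, y ^ i • j (n i)` from an induced module. -/
noncomputable def fromInducedAddHom (j : N →+ M) : Induced q N →+ M where
  toFun n := ∑ i : Fin (q + 1), y φ z ^ (i : ℕ) • j (n i)
  map_zero' := Finset.sum_eq_zero fun i _ => by rw [zero_induced_apply, map_zero, smul_zero]
  map_add' m n := by
    rw [← Finset.sum_add_distrib]
    exact Finset.sum_congr rfl fun i _ => by rw [add_induced_apply, map_add, smul_add]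

theorem fromInducedAddHom_apply (j : N →+ M) (n : Induced q N) :
    fromInducedAddHom (φ := φ) (z := z) j n = ∑ i : Fin (q + 1), y φ z ^ (i : ℕ) • j (n i) := rfl

theorem fromInducedAddHom_single (j : N →+ M) (i : Fin (q + 1)) (n : N) :
    fromInducedAddHom (φ := φ) (z := z) j (single q i n) = y φ z ^ (i : ℕ) • j n := by
  rw [fromInducedAddHom_apply, Finset.sum_eq_single i, single_same]
  · intro l _ hl
    rw [single_of_ne hl, map_zero, smul_zero]
  · simp

/-- `M` is the direct sum of its `φ ^ i z`-power torsion parts, and `y ^ i` identifies the image of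
`j`, the part `i = 0`, with the `i`-th. -/
theorem bijective_fromInducedAddHom (hφ : ∀ r, IsNilpotent ((φ ^ (q + 1)) r - r))
    (hz : ∀ i, 0 < i → i ≤ q → IsCoprime z ((φ ^ i) z))
    (hM : ∀ m : M, ∃ n : ℕ, x φ z ^ n • m = 0) (j : N →+ M) (hj : Function.Injective j)
    (hr : ∀ m : M, IsPowTorsion φ z z m ↔ ∃ n, j n = m) :
    Function.Bijective (fromInducedAddHom (φ := φ) (z := z) (q := q) j) := by
  let a (i : Fin (q + 1)) : R := (φ ^ (i : ℕ)) z
  have ha : Pairwise fun i l => IsCoprime (a i) (a l) := fun i l hil =>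
    isCoprime_pow_apply hz (Nat.lt_succ_iff.mp i.2) (Nat.lt_succ_iff.mp l.2) (Fin.val_ne_of_ne hil)
  let := baseModule φ z M
  constructor
  · rw [injective_iff_map_eq_zero]
    intro n hn
    funext i
    have hj' (i) : IsPowTorsion φ z z (j (n i)) := (hr _).mpr ⟨_, rfl⟩
    have h := eq_zero_of_sum_eq_zero_of_pairwise_isCoprime ha
      (f := fun i : Fin (q + 1) => y φ z ^ (i : ℕ) • j (n i)) (fun i => (hj' i).y_pow_smul i) hn i
    have h' := eq_zero_of_y_pow_smul_eq_zero hz (Nat.lt_succ_iff.mp i.2) (hj' i) h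
    exact hj (h'.trans (map_zero j).symm)
  · intro m
    obtain ⟨k, hk⟩ := hM m
    obtain ⟨e, he⟩ := isPowTorsion_prod_of_x_pow_smul_eq_zero (Nat.succ_pos q) hφ hk
    rw [Finset.prod_range] at he
    obtain ⟨f, hf, rfl⟩ := exists_eq_sum_of_pairwise_isCoprime ha he
    have hn (i : Fin (q + 1)) : ∃ n : N, y φ z ^ (i : ℕ) • j n = f i := by
      obtain ⟨m, hm, hm'⟩ := exists_y_pow_smul_eq hz (Nat.lt_succ_iff.mp i.2) ⟨e, hf i⟩
      obtain ⟨n, rfl⟩ := (hr m).mp hm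
      exact ⟨n, hm'⟩
    choose n hn using hn
    exact ⟨n, Eq.trans (fromInducedAddHom_apply j n) (Finset.sum_congr rfl fun i _ => hn i)⟩

variable [Module (GWA (φ ^ (q + 1)) z) N]

theorem fromInducedAddHom_smul (j : N →+ M) {a : GWA φ z}
    (h : ∀ i n, fromInducedAddHom (φ := φ) (z := z) j (a • single q i n) =
      a • y φ z ^ (i : ℕ) • j n) (n : Induced q N) :
    fromInducedAddHom (φ := φ) (z := z) j (a • n) = a • fromInducedAddHom (φ := φ) (z := z) j n := by
  rw [← sum_single n, Finset.smul_sum, map_sum, map_sum, Finset.smul_sum]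
  exact Finset.sum_congr rfl fun i _ => by rw [h, fromInducedAddHom_single]

/-- The linear map `n ↦ ∑ i, y ^ i • j (n i)` from an induced module. -/
noncomputable def fromInduced (j : N →+ M)
    (hc : ∀ r n, j (coeff (φ ^ (q + 1)) z r • n) = coeff φ z r • j n)
    (hx : ∀ n, y φ z ^ q • j (x (φ ^ (q + 1)) z • n) = x φ z • j n)
    (hy : ∀ n, j (y (φ ^ (q + 1)) z • n) = y φ z ^ (q + 1) • j n) :
    Induced q N →ₗ[GWA φ z] M :=
  linearMapMk (fromInducedAddHom (φ := φ) (z := z) j)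
    (fun r => fromInducedAddHom_smul j fun i n => by
      rw [coeff_smul_single, fromInducedAddHom_single, hc, smul_smul, smul_smul, y_pow_mul_coeff,
        pow_apply_inv_pow_apply])
    (fromInducedAddHom_smul j fun i n => by
      cases i using Fin.cases with
      | zero =>
        rw [x_smul_single_zero, fromInducedAddHom_single, Fin.val_last, hx, Fin.val_zero, pow_zero,
          one_smul]
      | succ i =>
        rw [x_smul_single_succ, fromInducedAddHom_single, hc, smul_smul, smul_smul,
          y_pow_mul_coeff, Fin.val_castSucc, inv_pow_succ_apply, pow_apply_inv_pow_apply,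
          Fin.val_succ, pow_succ', ← mul_assoc, x_mul_y])
    (fromInducedAddHom_smul j fun i n => by
      cases i using Fin.lastCases with
      | last =>
        rw [y_smul_single_last, fromInducedAddHom_single, hy, Fin.val_zero, pow_zero, one_smul,
          smul_smul, Fin.val_last, pow_succ']
      | cast i =>
        rw [y_smul_single_castSucc, fromInducedAddHom_single, smul_smul, Fin.val_succ, pow_succ',
          Fin.val_castSucc])

theorem locally_nilpotent_of_induced (hz : ∀ i, 0 < i → i ≤ q → IsCoprime z ((φ ^ i) z))
    (hM : ∀ m : M, ∃ n : ℕ, x φ z ^ n • m = 0) (j : N →+ M) (hj : Function.Injective j)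
    (hr : ∀ n, IsPowTorsion φ z z (j n))
    (hx : ∀ n, y φ z ^ q • j (x (φ ^ (q + 1)) z • n) = x φ z • j n) (n : N) :
    ∃ k : ℕ, x (φ ^ (q + 1)) z ^ k • n = 0 := by
  have key (k : ℕ) (n : N) (h : x φ z ^ ((q + 1) * k) • j n = 0) :
      x (φ ^ (q + 1)) z ^ k • n = 0 := by
    induction k generalizing n with
    | zero =>
      rw [mul_zero, pow_zero, one_smul] at h
      rw [hj (h.trans (map_zero j).symm), smul_zero]
    | succ k ih =>
      rw [pow_succ (x _ z), mul_smul]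
      apply ih
      -- Inverting `x ^ q * y ^ q` by `c` gives `X n = c x ^ q y ^ q X n = c x ^ (q + 1) n`: one `X`
      -- costs `q + 1` factors `x`.
      obtain ⟨c, hc⟩ := (hr (x (φ ^ (q + 1)) z • n)).exists_smul_eq (isCoprime_prod_inv_pow hz le_rfl)
      rw [← hc, map_mul, ← x_pow_mul_y_pow, mul_smul, mul_smul, hx, smul_smul (x φ z ^ q),
        ← pow_succ, smul_smul, x_pow_mul_coeff, mul_smul, smul_smul (x φ z ^ _), ← pow_add,
        ← mul_add_one, h, smul_zero]
  obtain ⟨k, hk⟩ := hM (j n)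
  exact ⟨k, key k n (x_pow_smul_eq_zero_of_le hk (Nat.le_mul_of_pos_left k (Nat.succ_pos q)))⟩

end EssentiallySurjective

/-! ### The equivalence of categories -/

section Equivalence

variable {R : Type u} [CommRing R] (φ : RingAut R) (z : R) (q : ℕ)

/-- Induction of modules from `H(R, φ ^ (q + 1), z)` to `H(R, φ, z)`. -/
noncomputable def inducedFunctor :
    ModuleCat.{w} (GWA (φ ^ (q + 1)) z) ⥤ ModuleCat.{w} (GWA φ z) where
  obj N := ModuleCat.of _ (Induced q N)
  map f := ModuleCat.ofHom (inducedMap f.hom)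

/-- Induction of modules, restricted to the categories `𝒪`. -/
noncomputable def inducedFunctorO :
    CategoryO.{u, w} (φ ^ (q + 1) : RingAut R) z ⥤ CategoryO.{u, w} φ z :=
  (isCategoryO.{u, w} φ z).lift
    ((isCategoryO.{u, w} (φ ^ (q + 1) : RingAut R) z).ι ⋙ inducedFunctor φ z q)
    fun N => induced_locally_nilpotent N.property

variable {φ z q}

theorem isEquivalence_inducedFunctorO (hφ : ∀ r, IsNilpotent ((φ ^ (q + 1)) r - r))
    (hz : ∀ i, 0 < i → i ≤ q → IsCoprime z ((φ ^ i) z)) :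
    (inducedFunctorO.{u, w} φ z q).IsEquivalence where
  faithful :=
    ⟨fun {_ _ f g} h => by
      ext1
      apply ModuleCat.hom_ext
      apply inducedMap_injective
      exact congrArg (fun F => F.hom.hom) h⟩
  full :=
    ⟨fun {N N'} f => by
      obtain ⟨g, hg⟩ := inducedMap_surjective
        (fun n : N.obj => isPowTorsion_of_x_pow_smul_eq_zero hφ (N.property n).choose_spec)
        (fun n : N'.obj => isPowTorsion_of_x_pow_smul_eq_zero hφ (N'.property n).choose_spec) hz
        f.hom.hom
      refine ⟨ObjectProperty.homMk (ModuleCat.ofHom g), ?_⟩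
      ext1
      exact ModuleCat.hom_ext hg⟩
  essSurj :=
    ⟨fun M => by
      obtain ⟨D, hc, hx, hy⟩ := exists_torsion_action (M := M.obj) hφ hz
      let := D.toModule
      let j : powTorsion φ z z M.obj →+ M.obj := (powTorsion φ z z M.obj).subtype
      have hj : Function.Injective j := Subtype.val_injective
      have hc' (r) (n : powTorsion φ z z M.obj) :
          j (coeff (φ ^ (q + 1)) z r • n) = coeff φ z r • j n := by
        rw [D.coeff_smul]; exact hc r n
      have hx' (n : powTorsion φ z z M.obj) :
          y φ z ^ q • j (x (φ ^ (q + 1)) z • n) = x φ z • j n := by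
        rw [D.x_smul]; exact hx n
      have hy' (n : powTorsion φ z z M.obj) :
          j (y (φ ^ (q + 1)) z • n) = y φ z ^ (q + 1) • j n := by
        rw [D.y_smul]; exact hy n
      refine ⟨⟨ModuleCat.of _ (powTorsion φ z z M.obj),
        locally_nilpotent_of_induced hz M.property j hj (fun n => n.2) hx'⟩,
        ⟨ObjectProperty.isoMk _ (LinearEquiv.toModuleIso
          (LinearEquiv.ofBijective (fromInduced j hc' hx' hy')
            (bijective_fromInducedAddHom hφ hz M.property j hj
              fun m => ⟨fun h => ⟨⟨m, h⟩, rfl⟩, ?_⟩)))⟩⟩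
      rintro ⟨n, rfl⟩
      exact n.2⟩

end Equivalence

end GWA

theorem mainTheorem3 {k : Type u} [CommRing k] (p : ℕ) (hp : p.Prime)
    (hnil : IsNilpotent (p : k)) {m : ℕ} (lam : Fin m → k)
    (hlam : ∀ i j : Fin m, lam i ≠ lam j → ∀ n : ℤ, IsUnit (lam i - lam j - (n : k)))
    (v : k[X]) (hv : v = ∏ i : Fin m, (X - C (lam i))) :
    Nonempty (CategoryOA.{u, w} v ≌ CategoryOAp.{u, w} v p) := by
  -- With `p = q + 1`, the range `0 < i ≤ q` is exactly `0 < i < p`.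
  obtain ⟨q, rfl⟩ := Nat.exists_eq_add_one.mpr hp.pos
  have := GWA.isEquivalence_inducedFunctorO.{u, w} (φ := polyShift k) (z := v) (q := q)
    (isNilpotent_polyShift_pow_sub hnil) (fun i hi hiq => by
      rw [hv]
      exact isCoprime_polyShift_pow hp hnil lam hlam hi (Nat.lt_succ_of_le hiq))
  exact ⟨(GWA.inducedFunctorO.{u, w} (polyShift k) v q).asEquivalence.symm⟩
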